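/- Let $d\ge 3$. A stacked $d$-polytope is a polytope obtained from a $d$-simplex by repeatedly (finitely often, possibly never) replacing the current polytope $P$ by $\operatorname{conv}(P\cup\{v\})$, where $v$ is a point in the affine hull of $P$ that lies beyond exactly one facet of $P$ and beneath all its other facets. (A point of the affine hull of $P$ is beyond, respectively beneath, a facet $F$ if it lies strictly on the opposite side, respectively strictly on the same side, of the affine hull of $F$ as $P$.) Theorem. Every stacked $d$-polytope $P$ has a realization that is truncatable, and this can be achieved with rational data. That is, there are a $d$-polytope $Q\subset\mathbb{R}^d$ whose face lattice is isomorphic to that of $P$ and, for every vertex $v$ of $Q$, a closed half-space $H_v=\{x : \ell_v(x)\le c_v\}$ that does not contain $v$ but contains all other vertices of $Q$ in its interior, such that for every edge $e$ of $Q$ the intersection $e\cap\bigcap_v H_v$ (over all vertices $v$ of $Q$) consists of exactly one point $u_e$, and $u_e$ is a relative interior point of $e$. Moreover, $Q$ and the $H_v$ can be chosen such that all vertices of $Q$ have rational coordinates, every linear form $\ell_v$ has rational coefficients, every $c_v$ is rational, and all the points $u_e$ have rational coordinates. -/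

import Mathlib

namespace ConvexPolytope

section General

variable {E : Type*} [NormedAddCommGroup E] [NormedSpace ℝ E]

/-- The set `P` is nonempty and its affine hull has dimension `k`. -/
def HasDim (k : ℕ) (P : Set E) : Prop :=
  P.Nonempty ∧ Module.finrank ℝ (vectorSpan ℝ P) = k

/-- A `d`-polytope: the convex hull of a finite set of points, of dimension `d`. -/
def IsPolytope (d : ℕ) (P : Set E) : Prop :=
  (∃ V : Finset E, P = convexHull ℝ (V : Set E)) ∧ HasDim d P

/-- A facet of a `d`-polytope: a face of dimension `d - 1`. Faces are exposed subsets; the empty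
set and the polytope itself count as faces. -/
def IsFacet (d : ℕ) (P F : Set E) : Prop :=
  IsExposed ℝ P F ∧ ∃ k, k + 1 = d ∧ HasDim k F

/-- The segment from `v` to `w` is an edge (a one-dimensional face) of `P`. -/
def IsEdge (P : Set E) (v w : E) : Prop :=
  v ≠ w ∧ IsExposed ℝ P (segment ℝ v w)

/-- The face lattice of `P`: all faces, including `∅` and `P`, ordered by inclusion. -/
abbrev FaceLattice (P : Set E) : Type _ := {F : Set E // IsExposed ℝ P F}

/-- The inequality `l x ≤ c` is valid on `P` and cuts out the face `F`. -/
def Defines (P F : Set E) (l : E →L[ℝ] ℝ) (c : ℝ) : Prop :=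
  (∀ x ∈ P, l x ≤ c) ∧ F = {x ∈ P | l x = c}

/-- The point `v` is beyond the facet `F` of `P`: it violates an inequality defining `F`. For a
point of the affine hull of `P`, the choice of the inequality defining `F` does not matter. -/
def IsBeyond (P F : Set E) (v : E) : Prop :=
  ∃ (l : E →L[ℝ] ℝ) (c : ℝ), Defines P F l c ∧ c < l v

/-- The point `v` is beneath the facet `F` of `P`: it strictly satisfies an inequality
defining `F`. -/
def IsBeneath (P F : Set E) (v : E) : Prop :=
  ∃ (l : E →L[ℝ] ℝ) (c : ℝ), Defines P F l c ∧ l v < c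

/-- Stacked `d`-polytopes: those obtained from a `d`-simplex by repeatedly adding a new vertex
(in the affine hull) that is beyond one facet and beneath all the other facets. -/
inductive IsStacked (d : ℕ) : Set E → Prop
  | simplex (p : Fin (d + 1) → E) (hp : AffineIndependent ℝ p) :
      IsStacked d (convexHull ℝ (Set.range p))
  | stack (P F : Set E) (v : E) (hP : IsStacked d P) (hF : IsFacet d P F)
      (hv : v ∈ affineSpan ℝ P) (hbeyond : IsBeyond P F v)
      (hbeneath : ∀ G, IsFacet d P G → G ≠ F → IsBeneath P G v) :
      IsStacked d (convexHull ℝ (insert v P))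

/-- The closed half-space `{x | l x ≤ c}` truncates the vertex `v` of `P`: it does not contain `v`,
but contains all the other vertices in its interior. -/
def TruncatesVertex (P : Set E) (v : E) (l : E →L[ℝ] ℝ) (c : ℝ) : Prop :=
  l ≠ 0 ∧ c < l v ∧ ∀ w ∈ P.extremePoints ℝ, w ≠ v → l w < c

/-- What is left of `P` when, for every vertex `v`, it is intersected with the
half-space `{x | l v x ≤ c v}`. -/
def truncate (P : Set E) (l : E → E →L[ℝ] ℝ) (c : E → ℝ) : Set E :=
  {x ∈ P | ∀ v ∈ P.extremePoints ℝ, l v x ≤ c v}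

/-- The half-spaces `{x | l v x ≤ c v}`, for `v` a vertex of `P`, truncate all the vertices of `P`
simultaneously in such a way that exactly one point, which is a relative interior point, remains
from each edge. The polytope `P` is truncatable if there are such half-spaces. (The values of `l`
and `c` at points that are not vertices play no role.) -/
def IsTruncation (P : Set E) (l : E → E →L[ℝ] ℝ) (c : E → ℝ) : Prop :=
  (∀ v ∈ P.extremePoints ℝ, TruncatesVertex P v (l v) (c v)) ∧
  ∀ v w, IsEdge P v w → ∃ u ∈ openSegment ℝ v w, segment ℝ v w ∩ truncate P l c = {u}

end General

/-- `P` and `Q` are combinatorially equivalent, i.e. `Q` is a realization of the combinatorial type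
of `P`: their face lattices are isomorphic. -/
def CombEquiv {E E' : Type*} [NormedAddCommGroup E] [NormedSpace ℝ E]
    [NormedAddCommGroup E'] [NormedSpace ℝ E'] (P : Set E) (Q : Set E') : Prop :=
  Nonempty (FaceLattice P ≃o FaceLattice Q)

/-- A point all of whose coordinates are rational. -/
def IsRationalPoint {d : ℕ} (x : EuclideanSpace ℝ (Fin d)) : Prop :=
  ∀ i, ∃ q : ℚ, x i = q

/-- The inequality `l x ≤ c` has rational coefficients and a rational right-hand side. -/
def IsRationalInequality {d : ℕ} (l : EuclideanSpace ℝ (Fin d) →L[ℝ] ℝ) (c : ℝ) : Prop :=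
  (∀ i, ∃ q : ℚ, l (EuclideanSpace.single i 1) = q) ∧ ∃ q : ℚ, c = q

end ConvexPolytope

/-! The combinatorial type of a stacked polytope depends only on which facets are stacked onto, so
when building a realization the new vertex may be placed anywhere beyond the chosen facet and
beneath the others. The induction (`IsStacked.exists_realization`) therefore carries one abstract
complex `𝓕` with two realizations: the given polytope, and a rational one with truncating
half-spaces.

To stack onto a facet `S`, let `y` be the average of the points kept on the edges of `S`. Each cut
holds weakly at all these points, and strictly at the point of an edge missing the cut vertex; such
an edge exists because `S` has at least three vertices. So `y` is interior to all half-spaces, lies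
on `S` and is beneath the other facets. A small rational push outward gives the apex `v`
(`exists_apex`). Now `v` is inside the half-space of each vertex `q i` of `S` while `q i` is
outside, so its boundary meets the new edge in a rational interior point. These `d` points lie on
one hyperplane, which cuts off `v`: add to the inequality of `S` suitable multiples of the
inequalities of the new facets (`exists_cut`). Old edges, including those of `S`, keep their points.

Control of the face lattice comes from `IsRealization`, which describes the polytope by the facet
inequalities indexed by `𝓕`. It survives stacking (`IsRealization.stack`) and makes the nontrivial
faces correspond to the subsets of members of `𝓕`, so two realizations of the same `𝓕` are
combinatorially equivalent. -/

namespace ConvexPolytope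

/-! ### Convex hulls, barycentric coordinates and averages of finite families. -/

section Realization

variable {E : Type*} [NormedAddCommGroup E] [NormedSpace ℝ E]

/-- Membership in the convex hull of a finite family of points, in terms of weights. -/
theorem mem_convexHull_range_iff {κ : Type*} [Fintype κ] (p : κ → E) (x : E) :
    x ∈ convexHull ℝ (Set.range p) ↔
      ∃ w : κ → ℝ, (∀ k, 0 ≤ w k) ∧ ∑ k, w k = 1 ∧ ∑ k, w k • p k = x := by
  constructor
  · intro hx
    rw [convexHull_range_eq_exists_affineCombination] at hx
    obtain ⟨s, w, hw0, hw1, rfl⟩ := hx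
    classical
    refine ⟨fun k => if k ∈ s then w k else 0, fun k => ?_, ?_, ?_⟩
    · dsimp only
      split_ifs with h
      exacts [hw0 k h, le_rfl]
    · simpa using hw1
    · rw [Finset.affineCombination_eq_linear_combination _ _ _ hw1]
      simp [ite_smul]
  · rintro ⟨w, h0, h1, rfl⟩
    exact (convex_convexHull ℝ _).sum_mem (fun k _ => h0 k) h1
      (fun k _ => subset_convexHull ℝ _ ⟨k, rfl⟩)

/-- The value of an affine function at an affine combination of points. -/
theorem map_sum_sub {κ : Type*} [Fintype κ] (p : κ → E) (w : κ → ℝ) {r : ℝ}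
    (hw : ∑ k, w k = r) (g : E →L[ℝ] ℝ) (c : ℝ) :
    g (∑ k, w k • p k) - r * c = ∑ k, w k * (g (p k) - c) := by
  simp only [map_sum, map_smul, smul_eq_mul, mul_sub, Finset.sum_sub_distrib, ← hw,
    Finset.sum_mul]

theorem le_of_mem_convexHull {κ : Type*} [Fintype κ] {p : κ → E} {x : E}
    (hx : x ∈ convexHull ℝ (Set.range p)) {g : E →L[ℝ] ℝ} {c : ℝ} (h : ∀ k, g (p k) ≤ c) :
    g x ≤ c := by
  obtain ⟨w, h0, h1, rfl⟩ := (mem_convexHull_range_iff p x).1 hx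
  have := map_sum_sub p w h1 g c
  have : ∑ k, w k * (g (p k) - c) ≤ 0 :=
    Finset.sum_nonpos fun k _ => mul_nonpos_of_nonneg_of_nonpos (h0 k) (sub_nonpos.2 (h k))
  linarith

/-- In a convex combination attaining the maximum `c`, every point with a smaller value must have
weight zero. -/
theorem mem_convexHull_of_map_eq {κ : Type*} [Fintype κ] {p : κ → E} {x : E}
    (hx : x ∈ convexHull ℝ (Set.range p)) {g : E →L[ℝ] ℝ} {c : ℝ} (h : ∀ k, g (p k) ≤ c)
    (hgx : g x = c) : x ∈ convexHull ℝ (p '' {k | g (p k) = c}) := by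
  classical
  obtain ⟨w, h0, h1, rfl⟩ := (mem_convexHull_range_iff p x).1 hx
  have hs := map_sum_sub p w h1 g c
  rw [hgx, one_mul, sub_self] at hs
  have hz := (Finset.sum_eq_zero_iff_of_nonpos fun k _ =>
    mul_nonpos_of_nonneg_of_nonpos (h0 k) (sub_nonpos.2 (h k))).1 hs.symm
  have hw : ∀ k, g (p k) ≠ c → w k = 0 := fun k hk =>
    (mul_eq_zero.1 (hz k (Finset.mem_univ k))).resolve_right (sub_ne_zero.2 hk)
  have hsub : Finset.univ.filter (fun k => g (p k) = c) ⊆ Finset.univ := Finset.subset_univ _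
  rw [← Finset.sum_subset hsub fun k _ hk => by rw [hw k (by simpa using hk), zero_smul]]
  rw [← Finset.sum_subset hsub fun k _ hk => hw k (by simpa using hk)] at h1
  exact (convex_convexHull ℝ _).sum_mem (fun k _ => h0 k) h1
    fun k hk => subset_convexHull ℝ _ ⟨k, by simpa using hk, rfl⟩

/-- Every point of the family can be cut off by a hyperplane that contains all the others. -/
def IsDualizable {κ : Type*} (p : κ → E) : Prop :=
  ∀ k, ∃ (g : E →L[ℝ] ℝ) (c : ℝ), (∀ j, j ≠ k → g (p j) = c) ∧ g (p k) < c

/-- An inequality that is tight at all points but one reads off the barycentric coordinate at that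
point, up to a nonzero factor. -/
theorem map_sum_sub_of_dual {κ : Type*} [Fintype κ] {p : κ → E} {k : κ} {g : E →L[ℝ] ℝ} {c : ℝ}
    (h : ∀ j, j ≠ k → g (p j) = c) (w : κ → ℝ) {r : ℝ} (hw : ∑ k, w k = r) :
    g (∑ k, w k • p k) - r * c = w k * (g (p k) - c) := by
  rw [map_sum_sub p w hw g c, Finset.sum_eq_single k]
  · intro j _ hj
    rw [h j hj, sub_self, mul_zero]
  · simp

theorem IsDualizable.affineIndependent {κ : Type*} [Fintype κ] {p : κ → E}
    (h : IsDualizable p) : AffineIndependent ℝ p := by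
  rw [affineIndependent_iff_of_fintype]
  intro w hw hv k
  rw [Finset.weightedVSub_eq_linear_combination _ hw] at hv
  obtain ⟨g, c, h1, h2⟩ := h k
  have := map_sum_sub_of_dual h1 w hw
  rw [hv, map_zero, zero_mul, sub_zero] at this
  exact (mul_eq_zero.1 this.symm).resolve_right (sub_ne_zero.2 h2.ne)

/-- The dual inequalities of a simplex determine the signs of the barycentric coordinates, so
satisfying all of them makes every weight nonnegative. -/
theorem mem_convexHull_of_dual {κ : Type*} [Fintype κ] {p : κ → E} {x : E}
    (hx : x ∈ affineSpan ℝ (Set.range p))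
    (h : ∀ k, ∃ (g : E →L[ℝ] ℝ) (c : ℝ), (∀ j, j ≠ k → g (p j) = c) ∧ g (p k) < c ∧ g x ≤ c) :
    x ∈ convexHull ℝ (Set.range p) := by
  obtain ⟨w, hw, rfl⟩ := eq_affineCombination_of_mem_affineSpan_of_fintype hx
  rw [Finset.affineCombination_eq_linear_combination _ _ _ hw] at h ⊢
  refine (mem_convexHull_range_iff _ _).2 ⟨w, fun k => ?_, hw, rfl⟩
  obtain ⟨g, c, h1, h2, h3⟩ := h k
  have := map_sum_sub_of_dual h1 w hw
  by_contra hk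
  have := mul_pos_of_neg_of_neg (not_le.1 hk) (sub_neg.2 h2)
  linarith

/-- The differences from `p k` are linearly independent, so some functional takes the value 1 on all
of them; finite dimension makes its extension to `E` continuous. -/
theorem _root_.AffineIndependent.isDualizable [FiniteDimensional ℝ E] {κ : Type*} {p : κ → E}
    (h : AffineIndependent ℝ p) : IsDualizable p := by
  intro k
  rw [affineIndependent_iff_linearIndependent_vsub ℝ p k] at h
  obtain ⟨g, hg⟩ := ((Finsupp.linearCombination ℝ fun _ => (1 : ℝ)).comp h.repr).exists_extend
  have key : ∀ j : {j // j ≠ k}, g (p j -ᵥ p k) = 1 := by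
    intro j
    have h1 := LinearMap.congr_fun hg ⟨p j -ᵥ p k, Submodule.subset_span ⟨j, rfl⟩⟩
    simp only [LinearMap.comp_apply, Submodule.subtype_apply] at h1
    rw [h1, h.repr_eq_single j _ rfl]
    simp
  refine ⟨LinearMap.toContinuousLinearMap g, g (p k) + 1, fun j hj => ?_, ?_⟩
  · have := key ⟨j, hj⟩
    rw [vsub_eq_sub, map_sub] at this
    simp only [LinearMap.coe_toContinuousLinearMap']
    linarith
  · simp

/-- Finitely many strict affine inequalities survive a small perturbation. -/
theorem exists_perturbation {κ : Type*} [Finite κ] (g : κ → E →L[ℝ] ℝ) (c : κ → ℝ) (y z : E)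
    (h : ∀ k, g k y < c k) : ∃ n : ℕ, ∀ k, g k (y + (1 / ((n : ℝ) + 1)) • z) < c k := by
  have hl : ∀ k, Filter.Tendsto (fun n : ℕ => g k (y + (1 / ((n : ℝ) + 1)) • z)) Filter.atTop
      (nhds (g k y)) := by
    intro k
    have := (tendsto_one_div_add_atTop_nhds_zero_nat (𝕜 := ℝ)).smul_const z
    have := ((g k).continuous.tendsto _).comp (this.const_add y)
    rw [zero_smul, add_zero] at this
    exact this
  exact (Filter.eventually_all.2 fun k => (hl k).eventually_lt_const (h k)).exists

/-- The average of a finite family of points. -/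
noncomputable def average {κ : Type*} (s : Finset κ) (u : κ → E) : E :=
  (s.card : ℝ)⁻¹ • ∑ k ∈ s, u k

theorem map_average_sub {κ : Type*} {s : Finset κ} (hs : s.Nonempty) (u : κ → E)
    (g : E →L[ℝ] ℝ) (c : ℝ) :
    g (average s u) - c = (s.card : ℝ)⁻¹ * ∑ k ∈ s, (g (u k) - c) := by
  have : (s.card : ℝ) ≠ 0 := by simpa using hs.ne_empty
  simp [average, mul_sub, this]

theorem map_average_eq {κ : Type*} {s : Finset κ} (hs : s.Nonempty) {u : κ → E}
    {g : E →L[ℝ] ℝ} {c : ℝ} (h : ∀ k ∈ s, g (u k) = c) : g (average s u) = c := by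
  rw [← sub_eq_zero, map_average_sub hs, Finset.sum_eq_zero fun k hk => sub_eq_zero.2 (h k hk),
    mul_zero]

theorem map_average_lt {κ : Type*} {s : Finset κ} {u : κ → E}
    {g : E →L[ℝ] ℝ} {c : ℝ} (h : ∀ k ∈ s, g (u k) ≤ c) (h' : ∃ k ∈ s, g (u k) < c) :
    g (average s u) < c := by
  have hs : s.Nonempty := h'.imp fun k hk => hk.1
  rw [← sub_neg, map_average_sub hs]
  have hc : (0 : ℝ) < s.card := by exact_mod_cast hs.card_pos
  refine mul_neg_of_pos_of_neg (inv_pos.2 hc) (Finset.sum_neg' (fun k hk => sub_nonpos.2 (h k hk)) ?_)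
  exact h'.imp fun k hk => ⟨hk.1, sub_neg.2 hk.2⟩

theorem average_mem_convexHull {κ : Type*} {s : Finset κ} (hs : s.Nonempty) (u : κ → E) :
    average s u ∈ convexHull ℝ (Set.range u) := by
  have hc : (s.card : ℝ) ≠ 0 := by simpa using hs.ne_empty
  rw [average, Finset.smul_sum]
  exact (convex_convexHull ℝ _).sum_mem (fun _ _ => by positivity) (by simp [hc])
    fun k _ => subset_convexHull ℝ _ ⟨k, rfl⟩

end Realization

end ConvexPolytope

namespace ConvexPolytope

/-! ### Combinatorics of stacking. -/

section Complexes

variable {ι : Type*} [DecidableEq ι]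

/-- A pure simplicial complex, given by its facets, all of which have `d` vertices, such that
every ridge of a facet is contained in another facet. -/
structure IsPseudomanifold (d : ℕ) (𝓕 : Set (Finset ι)) : Prop where
  card_eq : ∀ S ∈ 𝓕, S.card = d
  exists_adjacent : ∀ S ∈ 𝓕, ∀ i ∈ S, ∃ S' ∈ 𝓕, S.erase i ⊆ S' ∧ i ∉ S'

/-- The facets of the complex obtained by stacking a new vertex `none` onto the facet `S`. -/
def stackedFacets (𝓕 : Set (Finset ι)) (S : Finset ι) : Set (Finset (Option ι)) :=
  {R | (∃ S' ∈ 𝓕, S' ≠ S ∧ R = S'.map Function.Embedding.some) ∨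
    ∃ i ∈ S, R = Finset.insertNone (S.erase i)}

theorem IsPseudomanifold.exists_not_mem {d : ℕ} {𝓕 : Set (Finset ι)} (h : IsPseudomanifold d 𝓕)
    {S S' : Finset ι} (hS : S ∈ 𝓕) (hS' : S' ∈ 𝓕) (hne : S' ≠ S) : ∃ i ∈ S, i ∉ S' := by
  by_contra! hc
  exact hne (Finset.eq_of_subset_of_card_le hc (by rw [h.card_eq S hS, h.card_eq S' hS'])).symm

/-- If an old facet had the removed facet `S` as its neighbour, the neighbour becomes the cone over
`S` without a vertex outside that old facet. A cone over `S.erase i` meets the other cones along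
ridges through the apex, and the old neighbour of `S` along the base. -/
theorem IsPseudomanifold.stackedFacets {d : ℕ} {𝓕 : Set (Finset ι)} (h : IsPseudomanifold d 𝓕)
    (hd : 2 ≤ d) {S : Finset ι} (hS : S ∈ 𝓕) : IsPseudomanifold d (stackedFacets 𝓕 S) := by
  refine ⟨?_, ?_⟩
  · rintro R (⟨S', hS', -, rfl⟩ | ⟨i, hi, rfl⟩)
    · simpa using h.card_eq S' hS'
    · have := h.card_eq S hS
      rw [Finset.card_insertNone, Finset.card_erase_of_mem hi]
      omega
  · rintro R (⟨S', hS', hne, rfl⟩ | ⟨i, hi, rfl⟩) o ho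
    · obtain ⟨i, hi, rfl⟩ := Finset.mem_map.1 ho
      obtain ⟨T, hT, h1, h2⟩ := h.exists_adjacent S' hS' i hi
      rw [Finset.subset_iff] at h1
      by_cases hTS : T = S
      · subst hTS
        obtain ⟨j, hj, hj'⟩ := h.exists_not_mem hT hS' hne
        refine ⟨_, Or.inr ⟨j, hj, rfl⟩, ?_, ?_⟩
        · intro o
          cases o with
          | none => simp
          | some k =>
            have := h1 (x := k)
            simp [Finset.mem_insertNone] at this ⊢
            grind
        · simp [Finset.mem_insertNone, h2]
      · refine ⟨_, Or.inl ⟨T, hT, hTS, rfl⟩, ?_, by simpa using h2⟩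
        intro o
        simp only [Finset.mem_erase, Finset.mem_map, Function.Embedding.some_apply]
        rintro ⟨ho, a, ha, rfl⟩
        exact ⟨a, h1 (Finset.mem_erase.2 ⟨fun hc => ho (by simp [hc]), ha⟩), rfl⟩
    · cases o with
      | none =>
        obtain ⟨T, hT, h1, h2⟩ := h.exists_adjacent S hS i hi
        refine ⟨_, Or.inl ⟨T, hT, fun hc => h2 (hc ▸ hi), rfl⟩, ?_, by simp⟩
        intro o
        cases o with
        | none => simp
        | some k =>
          intro hk
          have := h1 (x := k)
          simp [Finset.mem_insertNone] at hk this ⊢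
          grind
      | some j =>
        have hj : j ≠ i ∧ j ∈ S := by simpa [Finset.mem_insertNone] using ho
        refine ⟨_, Or.inr ⟨j, hj.2, rfl⟩, ?_, by simp [Finset.mem_insertNone]⟩
        intro o
        cases o with
        | none => simp
        | some k =>
          simp [Finset.mem_insertNone]
          grind

/-- The facets of the boundary complex of a simplex. -/
def simplexFacets (d : ℕ) : Set (Finset (Fin (d + 1))) := {S | ∃ i, S = Finset.univ.erase i}

theorem isPseudomanifold_simplexFacets (d : ℕ) : IsPseudomanifold d (simplexFacets d) := by
  refine ⟨?_, ?_⟩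
  · rintro _ ⟨i, rfl⟩
    simp
  · rintro _ ⟨i, rfl⟩ j hj
    refine ⟨_, ⟨j, rfl⟩, ?_, by simp⟩
    intro k
    simp only [Finset.mem_erase, Finset.mem_univ]
    tauto

end Complexes

/-! ### Simplicial polytopes given by supporting inequalities, and their face lattices. -/

section Realization

variable {E : Type*} [NormedAddCommGroup E] [NormedSpace ℝ E] {ι : Type*}

/-- The inequality `f x ≤ c` is valid for all the points, with equality exactly on `T`. -/
def Supports (p : ι → E) (T : Set ι) (f : E →L[ℝ] ℝ) (c : ℝ) : Prop :=
  (∀ i ∈ T, f (p i) = c) ∧ ∀ i ∉ T, f (p i) < c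

theorem Supports.le {p : ι → E} {T : Set ι} {f : E →L[ℝ] ℝ} {c : ℝ} (h : Supports p T f c)
    (i : ι) : f (p i) ≤ c := by
  by_cases hi : i ∈ T
  exacts [(h.1 i hi).le, (h.2 i hi).le]

theorem Supports.setOf_eq {p : ι → E} {T : Set ι} {f : E →L[ℝ] ℝ} {c : ℝ}
    (h : Supports p T f c) : {i | f (p i) = c} = T := by
  ext i
  exact ⟨fun hi => by_contra fun hc => (h.2 i hc).ne hi, h.1 i⟩

theorem Supports.mem_convexHull_iff [Fintype ι] {p : ι → E} {T : Set ι} {f : E →L[ℝ] ℝ} {c : ℝ}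
    (h : Supports p T f c) (x : E) :
    x ∈ convexHull ℝ (p '' T) ↔ x ∈ convexHull ℝ (Set.range p) ∧ f x = c := by
  constructor
  · intro hx
    refine ⟨convexHull_mono (Set.image_subset_range _ _) hx, ?_⟩
    have : convexHull ℝ (p '' T) ⊆ {x | f x = c} := by
      refine convexHull_min ?_ ?_
      · rintro _ ⟨i, hi, rfl⟩
        exact h.1 i hi
      · exact convex_hyperplane f.isLinear c
    exact this hx
  · rintro ⟨hx, hfx⟩
    have := mem_convexHull_of_map_eq hx h.le hfx
    rwa [h.setOf_eq] at this

theorem Supports.mem_iff [Fintype ι] {p : ι → E} {T : Set ι} {f : E →L[ℝ] ℝ} {c : ℝ}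
    (h : Supports p T f c) (i : ι) : p i ∈ convexHull ℝ (p '' T) ↔ i ∈ T := by
  rw [h.mem_convexHull_iff, ← h.setOf_eq]
  exact ⟨fun h => h.2, fun h => ⟨subset_convexHull ℝ _ ⟨i, rfl⟩, h⟩⟩

/-- The face determines at which `p i` a defining inequality is tight. This turns the inequalities
witnessing "beyond" and "beneath" into supporting ones. -/
theorem Supports.of_defines [Fintype ι] {p : ι → E} {T : Set ι} {f f' : E →L[ℝ] ℝ} {c c' : ℝ}
    (h : Supports p T f c)
    (h' : Defines (convexHull ℝ (Set.range p)) (convexHull ℝ (p '' T)) f' c') :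
    Supports p T f' c' := by
  have key : ∀ i, i ∈ T ↔ f' (p i) = c' := by
    intro i
    rw [← h.mem_iff i, h'.2]
    exact ⟨fun h => h.2, fun h => ⟨subset_convexHull ℝ _ ⟨i, rfl⟩, h⟩⟩
  exact ⟨fun i hi => (key i).1 hi, fun i hi =>
    (h'.1 _ (subset_convexHull ℝ _ ⟨i, rfl⟩)).lt_of_ne fun hc => hi ((key i).2 hc)⟩

theorem Supports.isExposed [Fintype ι] {p : ι → E} {T : Set ι} {f : E →L[ℝ] ℝ} {c : ℝ}
    (h : Supports p T f c) :
    IsExposed ℝ (convexHull ℝ (Set.range p)) (convexHull ℝ (p '' T)) := by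
  rintro ⟨x, hx⟩
  refine ⟨f, ?_⟩
  rw [h.mem_convexHull_iff] at hx
  ext y
  rw [h.mem_convexHull_iff]
  constructor
  · rintro ⟨hy, rfl⟩
    exact ⟨hy, fun z hz => le_of_mem_convexHull hz h.le⟩
  · rintro ⟨hy, h1⟩
    exact ⟨hy, (le_of_mem_convexHull hy h.le).antisymm (hx.2 ▸ h1 x hx.1)⟩

/-- The convex hull of the points is a simplicial `d`-polytope, the facets of which are the convex
hulls of the subfamilies in `𝓕`. -/
structure IsRealization (d : ℕ) (𝓕 : Set (Finset ι)) (p : ι → E) : Prop where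
  finrank_eq : Module.finrank ℝ (vectorSpan ℝ (Set.range p)) = d
  exists_supports : ∀ S ∈ 𝓕, ∃ f c, Supports p (S : Set ι) f c
  mem_convexHull : ∀ (f : Finset ι → E →L[ℝ] ℝ) (c : Finset ι → ℝ),
    (∀ S ∈ 𝓕, Supports p (S : Set ι) (f S) (c S)) →
    ∀ x ∈ affineSpan ℝ (Set.range p), (∀ S ∈ 𝓕, f S x ≤ c S) → x ∈ convexHull ℝ (Set.range p)

variable {d : ℕ} {𝓕 : Set (Finset ι)} {p : ι → E}

/-- The vertex sets of the faces of a simplicial polytope with facets `𝓕`. -/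
def faceSets (𝓕 : Set (Finset ι)) : Set (Set ι) :=
  {T | T = Set.univ ∨ T = ∅ ∨ ∃ S ∈ 𝓕, T ⊆ S}

/-- A face `T` of a facet `S` is the intersection of `S` with the facets adjacent to it across the
ridges `S.erase i`, `i ∈ S \ T`; the sum of all their inequalities supports exactly `T`. -/
theorem IsRealization.exists_supports_of_mem_faceSets [DecidableEq ι] (h : IsRealization d 𝓕 p)
    (h𝓕 : IsPseudomanifold d 𝓕) {T : Set ι} (hT : T ∈ faceSets 𝓕) : ∃ f c, Supports p T f c := by
  classical
  rcases hT with rfl | rfl | ⟨S, hS, hTS⟩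
  · exact ⟨0, 0, by simp [Supports]⟩
  · exact ⟨0, 1, by simp [Supports]⟩
  · obtain ⟨f, c, hf⟩ := h.exists_supports S hS
    have : ∀ i, ∃ f c, i ∈ S → Supports p {j | f (p j) = c} f c ∧ f (p i) < c ∧
        ∀ j ∈ S, j ≠ i → f (p j) = c := by
      intro i
      by_cases hi : i ∈ S
      · obtain ⟨S', hS', h1, h2⟩ := h𝓕.exists_adjacent S hS i hi
        obtain ⟨f', c', hf'⟩ := h.exists_supports S' hS'
        exact ⟨f', c', fun _ => ⟨hf'.setOf_eq.symm ▸ hf', hf'.2 i (by simpa using h2),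
          fun j hj hji => hf'.1 j (by simpa using h1 (Finset.mem_erase.2 ⟨hji, hj⟩))⟩⟩
      · exact ⟨0, 0, fun h => absurd h hi⟩
    choose g b hg using this
    have heval : ∀ x, (f + ∑ i ∈ S.filter (· ∉ T), g i) x - (c + ∑ i ∈ S.filter (· ∉ T), b i) =
        (f x - c) + ∑ i ∈ S.filter (· ∉ T), (g i x - b i) := by
      intro x
      simp only [add_apply, sum_apply,
        Finset.sum_sub_distrib]
      ring
    have hle : ∀ x, ∑ i ∈ S.filter (· ∉ T), (g i (p x) - b i) ≤ 0 := fun x =>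
      Finset.sum_nonpos fun i hi =>
        sub_nonpos.2 ((hg i (Finset.mem_filter.1 hi).1).1.le x)
    refine ⟨f + ∑ i ∈ S.filter (· ∉ T), g i, c + ∑ i ∈ S.filter (· ∉ T), b i, ?_, ?_⟩
    · intro i hi
      rw [← sub_eq_zero, heval, hf.1 i (hTS hi), sub_self, zero_add]
      refine Finset.sum_eq_zero fun j hj => ?_
      rw [Finset.mem_filter] at hj
      rw [(hg j hj.1).2.2 i (hTS hi) (by rintro rfl; exact hj.2 hi), sub_self]
    · intro i hi
      rw [← sub_neg, heval]
      by_cases hiS : i ∈ S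
      · have := hf.le i
        have : ∑ j ∈ S.filter (· ∉ T), (g j (p i) - b j) < 0 :=
          Finset.sum_neg' (fun j hj =>
            sub_nonpos.2 ((hg j (Finset.mem_filter.1 hj).1).1.le i))
            ⟨i, Finset.mem_filter.2 ⟨hiS, hi⟩, sub_neg.2 (hg i hiS).2.1⟩
        linarith
      · have := hf.2 i (by simpa using hiS)
        have := hle i
        linarith

/-- If the tight set is nonempty and in no facet, the average of its points strictly satisfies every
facet inequality. If it is also proper, moving from there slightly away from a point with `g (p k) <
b` stays in the polytope but violates `g ≤ b`. -/
theorem IsRealization.mem_faceSets_of_le [Fintype ι] (h : IsRealization d 𝓕 p) {g : E →L[ℝ] ℝ} {b : ℝ}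
    (hg : ∀ i, g (p i) ≤ b) : {i | g (p i) = b} ∈ faceSets 𝓕 := by
  classical
  by_contra hc
  simp only [faceSets, Set.mem_ofPred_eq, not_or, not_exists, not_and] at hc
  obtain ⟨h1, h2, h3⟩ := hc
  have : ∀ S, ∃ f c, S ∈ 𝓕 → Supports p (S : Set ι) f c := by
    intro S
    by_cases hS : S ∈ 𝓕
    · obtain ⟨f, c, hf⟩ := h.exists_supports S hS
      exact ⟨f, c, fun _ => hf⟩
    · exact ⟨0, 0, fun h => absurd h hS⟩
  choose f c hf using this
  obtain ⟨k, hk⟩ := (Set.ne_univ_iff_exists_notMem _).1 h1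
  obtain ⟨j, hj⟩ := Set.nonempty_iff_ne_empty.2 h2
  set s : Finset ι := Finset.univ.filter fun i => g (p i) = b with hs
  have hsne : s.Nonempty := ⟨j, by simpa [hs] using hj⟩
  set y := average s p with hy
  have hyg : g y = b := map_average_eq hsne fun i hi => (Finset.mem_filter.1 hi).2
  have hyconv : y ∈ convexHull ℝ (Set.range p) := average_mem_convexHull hsne p
  have hyf : ∀ S : 𝓕, f S y < c S := by
    rintro ⟨S, hS⟩
    refine map_average_lt (fun i _ => (hf S hS).le i) ?_
    obtain ⟨i, hi, hiS⟩ := Set.not_subset.1 (h3 S hS)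
    exact ⟨i, by simpa [hs] using hi, (hf S hS).2 i hiS⟩
  obtain ⟨n, hn⟩ := exists_perturbation (fun S : 𝓕 => f S) (fun S => c S) y (y - p k) hyf
  have hpos : (0 : ℝ) < 1 / ((n : ℝ) + 1) := by positivity
  have hmem : y + (1 / ((n : ℝ) + 1)) • (y - p k) ∈ convexHull ℝ (Set.range p) := by
    refine h.mem_convexHull f c hf _ ?_ fun S hS => (hn ⟨S, hS⟩).le
    have h1 := convexHull_subset_affineSpan (𝕜 := ℝ) _ hyconv
    have h2 := AffineSubspace.smul_vsub_vadd_mem (affineSpan ℝ (Set.range p)) (1 / ((n : ℝ) + 1))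
      h1 (subset_affineSpan ℝ _ ⟨k, rfl⟩) h1
    rwa [vsub_eq_sub, vadd_eq_add, add_comm] at h2
  have h4 := le_of_mem_convexHull hmem hg
  simp only [map_add, map_smul, map_sub, smul_eq_mul, hyg] at h4
  have h5 : g (p k) < b := (hg k).lt_of_ne hk
  have := mul_pos hpos (sub_pos.2 h5)
  linarith

/-- The vertex set of a face belongs to the complex, and the face is the convex hull of its
vertices. -/
theorem IsRealization.mem_faceSets_of_isExposed [Fintype ι] (h : IsRealization d 𝓕 p) {F : Set E}
    (hF : IsExposed ℝ (convexHull ℝ (Set.range p)) F) :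
    {i | p i ∈ F} ∈ faceSets 𝓕 ∧ F = convexHull ℝ (p '' {i | p i ∈ F}) := by
  rcases F.eq_empty_or_nonempty with rfl | hne
  · exact ⟨Or.inr (Or.inl rfl), by simp⟩
  · obtain ⟨g, hg⟩ := hF hne
    obtain ⟨x, hx⟩ := hne
    have hx' := hx
    rw [hg] at hx'
    have hle : ∀ i, g (p i) ≤ g x := fun i => hx'.2 _ (subset_convexHull ℝ _ ⟨i, rfl⟩)
    have heq : {i | p i ∈ F} = {i | g (p i) = g x} := by
      ext i
      simp only [hg, Set.mem_ofPred_eq]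
      refine ⟨fun hi => (hle i).antisymm (hi.2 x hx'.1), fun hi => ⟨subset_convexHull ℝ _ ⟨i, rfl⟩,
        fun y hy => hi ▸ hx'.2 y hy⟩⟩
    refine ⟨heq ▸ h.mem_faceSets_of_le hle, ?_⟩
    apply Set.Subset.antisymm
    · intro y hy
      rw [heq]
      rw [hg] at hy
      exact mem_convexHull_of_map_eq hy.1 hle ((hx'.2 y hy.1).antisymm (hy.2 x hx'.1))
    · refine convexHull_min ?_ (hF.convex (convex_convexHull ℝ _))
      rintro _ ⟨i, hi, rfl⟩
      exact hi

/-- The face lattice of a simplicial polytope, in terms of its vertex sets. -/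
def IsRealization.faceLatticeIso [Fintype ι] [DecidableEq ι] (h : IsRealization d 𝓕 p) (h𝓕 : IsPseudomanifold d 𝓕) :
    FaceLattice (convexHull ℝ (Set.range p)) ≃o faceSets 𝓕 where
  toFun F := ⟨{i | p i ∈ F.1}, (h.mem_faceSets_of_isExposed F.2).1⟩
  invFun T := ⟨convexHull ℝ (p '' T.1), by
    obtain ⟨f, c, hf⟩ := h.exists_supports_of_mem_faceSets h𝓕 T.2
    exact hf.isExposed⟩
  left_inv F := Subtype.ext (h.mem_faceSets_of_isExposed F.2).2.symm
  right_inv T := by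
    obtain ⟨f, c, hf⟩ := h.exists_supports_of_mem_faceSets h𝓕 T.2
    exact Subtype.ext (Set.ext hf.mem_iff)
  map_rel_iff' := by
    rintro ⟨F, hF⟩ ⟨G, hG⟩
    constructor
    · intro hFG
      change F ⊆ G
      rw [(h.mem_faceSets_of_isExposed hF).2, (h.mem_faceSets_of_isExposed hG).2]
      exact convexHull_mono (Set.image_mono hFG)
    · intro hFG i hi
      exact hFG hi

theorem IsRealization.combEquiv [Fintype ι] [DecidableEq ι] {E' : Type*} [NormedAddCommGroup E'] [NormedSpace ℝ E']
    {q : ι → E'} (h : IsRealization d 𝓕 p) (h' : IsRealization d 𝓕 q)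
    (h𝓕 : IsPseudomanifold d 𝓕) :
    CombEquiv (convexHull ℝ (Set.range p)) (convexHull ℝ (Set.range q)) :=
  ⟨(h.faceLatticeIso h𝓕).trans (h'.faceLatticeIso h𝓕).symm⟩

theorem IsRealization.hasDim (h : IsRealization d 𝓕 p) (hd : 1 ≤ d) :
    HasDim d (convexHull ℝ (Set.range p)) := by
  constructor
  · rw [convexHull_nonempty_iff, Set.nonempty_iff_ne_empty]
    intro he
    have := h.finrank_eq
    rw [he] at this
    rw [vectorSpan_empty, finrank_bot] at this
    omega
  · rw [← direction_affineSpan, affineSpan_convexHull, direction_affineSpan, h.finrank_eq]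

/-- The restriction of a realization to a facet is affinely independent. -/
theorem IsRealization.affineIndependent [DecidableEq ι] (h : IsRealization d 𝓕 p) (h𝓕 : IsPseudomanifold d 𝓕)
    {S : Finset ι} (hS : S ∈ 𝓕) : AffineIndependent ℝ (fun i : S => p i) := by
  refine IsDualizable.affineIndependent fun ⟨i, hi⟩ => ?_
  obtain ⟨S', hS', h1, h2⟩ := h𝓕.exists_adjacent S hS i hi
  obtain ⟨f, c, hf⟩ := h.exists_supports S' hS'
  refine ⟨f, c, ?_, hf.2 i (by simpa using h2)⟩
  rintro ⟨j, hj⟩ hji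
  exact hf.1 j (h1 (Finset.mem_erase.2 ⟨fun hc => hji (Subtype.ext hc), hj⟩))

theorem IsRealization.isFacet [Fintype ι] [DecidableEq ι] (h : IsRealization d 𝓕 p) (h𝓕 : IsPseudomanifold d 𝓕) (hd : 1 ≤ d)
    {S : Finset ι} (hS : S ∈ 𝓕) :
    IsFacet d (convexHull ℝ (Set.range p)) (convexHull ℝ (p '' S)) := by
  obtain ⟨f, c, hf⟩ := h.exists_supports S hS
  have hcard := h𝓕.card_eq S hS
  refine ⟨hf.isExposed, d - 1, by omega, ?_, ?_⟩
  · rw [convexHull_nonempty_iff]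
    exact (Finset.card_pos.1 (by omega : 0 < S.card)).to_set.image p
  · rw [← direction_affineSpan, affineSpan_convexHull, direction_affineSpan]
    have := (h.affineIndependent h𝓕 hS).finrank_vectorSpan (n := d - 1) (by simp; omega)
    rwa [Set.range_comp' p (fun i : S => (i : ι)), Subtype.range_coe_subtype] at this

/-- A face of dimension `d - 1` needs at least `d` vertices, while a proper face has its vertices
inside some `S ∈ 𝓕` with exactly `d` elements. -/
theorem IsRealization.exists_of_isFacet [Fintype ι] [DecidableEq ι] (h : IsRealization d 𝓕 p) (h𝓕 : IsPseudomanifold d 𝓕)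
    {F : Set E} (hF : IsFacet d (convexHull ℝ (Set.range p)) F) :
    ∃ S ∈ 𝓕, F = convexHull ℝ (p '' S) := by
  classical
  obtain ⟨hexp, k, hk, hne, hdim⟩ := hF
  obtain ⟨h1, h2⟩ := h.mem_faceSets_of_isExposed hexp
  set T := {i | p i ∈ F} with hT
  rw [h2, convexHull_nonempty_iff] at hne
  rw [h2, ← direction_affineSpan, affineSpan_convexHull, direction_affineSpan] at hdim
  rcases h1 with h1 | h1 | ⟨S, hS, hTS⟩
  · rw [h1, Set.image_univ, h.finrank_eq] at hdim
    omega
  · rw [h1] at hne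
    simp at hne
  · refine ⟨S, hS, ?_⟩
    rw [h2]
    congr 2
    obtain ⟨t, ht⟩ : ∃ t : Finset ι, (t : Set ι) = T := ⟨T.toFinset, by simp⟩
    rw [← ht] at hTS hne hdim ⊢
    have htn : t.Nonempty := by simpa using hne
    have := finrank_vectorSpan_image_finset_le ℝ p t (n := t.card - 1)
      (by have := htn.card_pos; omega)
    rw [Finset.coe_image] at this
    have h3 := h𝓕.card_eq S hS
    rw [Finset.coe_subset] at hTS
    have hcard : S.card ≤ t.card := by
      have := htn.card_pos
      omega
    rw [Finset.eq_of_subset_of_card_le hTS hcard]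

end Realization

end ConvexPolytope

namespace ConvexPolytope

/-! ### Stacking a realization. -/

section Stacking

variable {E : Type*} {ι : Type*}

/-- The family of points `p`, with the new point `v` at index `none`. -/
def stackedPoints (p : ι → E) (v : E) (o : Option ι) : E := o.elim v p

@[simp] theorem stackedPoints_none (p : ι → E) (v : E) : stackedPoints p v none = v := rfl

@[simp] theorem stackedPoints_some (p : ι → E) (v : E) (i : ι) :
    stackedPoints p v (some i) = p i := rfl

theorem range_stackedPoints (p : ι → E) (v : E) :
    Set.range (stackedPoints p v) = insert v (Set.range p) := by
  ext x
  simp [Option.exists, eq_comm]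

variable [NormedAddCommGroup E] [NormedSpace ℝ E]

theorem affineSpan_range_stackedPoints {p : ι → E} {v : E}
    (hv : v ∈ affineSpan ℝ (Set.range p)) :
    affineSpan ℝ (Set.range (stackedPoints p v)) = affineSpan ℝ (Set.range p) := by
  rw [range_stackedPoints, affineSpan_insert_eq_affineSpan ℝ hv]

theorem supports_stackedPoints_map_some {p : ι → E} {v : E} {S : Finset ι} {f : E →L[ℝ] ℝ}
    {c : ℝ} :
    Supports (stackedPoints p v) (S.map Function.Embedding.some : Set (Option ι)) f c ↔
      Supports p (S : Set ι) f c ∧ f v < c := by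
  simp [Supports, Option.forall]
  tauto

theorem supports_stackedPoints_insertNone {p : ι → E} {v : E} {S : Finset ι} {f : E →L[ℝ] ℝ}
    {c : ℝ} :
    Supports (stackedPoints p v) (Finset.insertNone S : Set (Option ι)) f c ↔
      Supports p (S : Set ι) f c ∧ f v = c := by
  simp [Supports, Option.forall, Finset.mem_insertNone]
  tauto

variable [DecidableEq ι]

/-- The hyperplane through a ridge of the facet `S` and through a point beyond `S`. -/
theorem Supports.insertNone_erase {p : ι → E} {v : E} {S S' : Finset ι} {f f' : E →L[ℝ] ℝ}
    {c c' : ℝ} (h : Supports p (S : Set ι) f c) (h' : Supports p (S' : Set ι) f' c') {i : ι}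
    (hSS' : S.erase i ⊆ S') (hi : i ∉ S') (hv : c < f v) (hv' : f' v < c') :
    Supports (stackedPoints p v) (Finset.insertNone (S.erase i) : Set (Option ι))
      ((c' - f' v) • f + (f v - c) • f') ((c' - f' v) * c + (f v - c) * c') := by
  rw [supports_stackedPoints_insertNone]
  -- Each functional is weighted by the slack of the other at `v`, so the deviations cancel there;
  -- both weights are positive.
  have h1 := sub_pos.2 hv
  have h2 := sub_pos.2 hv'
  refine ⟨⟨fun j hj => ?_, fun j hj => ?_⟩, ?_⟩
  · have hjS : j ∈ (S : Set ι) := Finset.mem_of_mem_erase hj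
    simp [h.1 j hjS, h'.1 j (hSS' hj)]
  · simp only [add_apply, smul_apply, smul_eq_mul]
    by_cases hjS : j ∈ S
    · have hji : j = i := by simpa [hjS] using hj
      rw [h.1 j hjS]
      have := mul_lt_mul_of_pos_left (h'.2 j (by simpa [hji] using hi)) h1
      linarith
    · have := mul_lt_mul_of_pos_left (h.2 j (by simpa using hjS)) h2
      have := mul_le_mul_of_nonneg_left (h'.le j) h1.le
      linarith
  · simp only [add_apply, smul_apply, smul_eq_mul]
    ring

variable [Fintype ι] {d : ℕ} {𝓕 : Set (Finset ι)} {p : ι → E}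

/-- The hyperplane of `S` splits the new polytope into the old one and the simplex spanned by `S`
and `v`; the new facet inequalities confine a point to one of these two pieces. -/
theorem IsRealization.stack (h : IsRealization d 𝓕 p) (h𝓕 : IsPseudomanifold d 𝓕)
    {S : Finset ι} (hS : S ∈ 𝓕) {v : E} (hv : v ∈ affineSpan ℝ (Set.range p))
    {f : E →L[ℝ] ℝ} {c : ℝ} (hf : Supports p (S : Set ι) f c) (hfv : c < f v)
    (hbeneath : ∀ S' ∈ 𝓕, S' ≠ S → ∃ f' c', Supports p (S' : Set ι) f' c' ∧ f' v < c') :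
    IsRealization d (stackedFacets 𝓕 S) (stackedPoints p v) := by
  have hspan := affineSpan_range_stackedPoints hv
  have hfin : Module.finrank ℝ (vectorSpan ℝ (Set.range (stackedPoints p v))) = d := by
    rw [← direction_affineSpan, hspan, direction_affineSpan, h.finrank_eq]
  refine ⟨hfin, ?_, ?_⟩
  · rintro R (⟨S', hS', hne, rfl⟩ | ⟨i, hi, rfl⟩)
    · obtain ⟨f', c', h1, h2⟩ := hbeneath S' hS' hne
      exact ⟨f', c', supports_stackedPoints_map_some.2 ⟨h1, h2⟩⟩
    · obtain ⟨S', hS', h1, h2⟩ := h𝓕.exists_adjacent S hS i hi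
      obtain ⟨f', c', h3, h4⟩ := hbeneath S' hS' (by rintro rfl; exact h2 hi)
      exact ⟨_, _, hf.insertNone_erase h3 h1 h2 hfv h4⟩
  · intro g b hg x hx hxg
    rw [hspan] at hx
    have hg1 : ∀ S' ∈ 𝓕, S' ≠ S → Supports p (S' : Set ι) (g (S'.map Function.Embedding.some))
        (b (S'.map Function.Embedding.some)) := fun S' hS' hne =>
      (supports_stackedPoints_map_some.1 (hg _ (Or.inl ⟨S', hS', hne, rfl⟩))).1
    rcases le_or_gt (f x) c with hfx | hfx
    · have := h.mem_convexHull
        (fun T => if T = S then f else g (T.map Function.Embedding.some))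
        (fun T => if T = S then c else b (T.map Function.Embedding.some))
        (fun T hT => by
          by_cases hTS : T = S
          · subst hTS
            simpa using hf
          · simpa [hTS] using hg1 T hT hTS) x hx
        (fun T hT => by
          by_cases hTS : T = S
          · simpa [hTS] using hfx
          · simpa [hTS] using hxg _ (Or.inl ⟨T, hT, hTS, rfl⟩))
      rw [range_stackedPoints]
      exact convexHull_mono (Set.subset_insert _ _) this
    -- Beyond `S`, the point satisfies the dual inequalities of the simplex on `S` and `v`: the
    -- reversed inequality of `S` opposite `v`, and the new facet inequality opposite each `i ∈ S`.
    · let r : Finset.insertNone S → E := fun o => stackedPoints p v o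
      have hdual : ∀ k, ∃ (g : E →L[ℝ] ℝ) (c : ℝ),
          (∀ j, j ≠ k → g (r j) = c) ∧ g (r k) < c ∧ g x ≤ c := by
        rintro ⟨o, ho⟩
        cases o with
        | none =>
          refine ⟨-f, -c, ?_, by simpa [r] using hfv, by simpa using hfx.le⟩
          rintro ⟨o, hj⟩ hne
          cases o with
          | none => exact absurd rfl hne
          | some j => simpa [r] using hf.1 j (by simpa using hj)
        | some i =>
          have hi : i ∈ S := by simpa using ho
          have hR : Finset.insertNone (S.erase i) ∈ stackedFacets 𝓕 S := Or.inr ⟨i, hi, rfl⟩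
          have hsup := hg _ hR
          refine ⟨g (Finset.insertNone (S.erase i)), b (Finset.insertNone (S.erase i)), ?_,
            hsup.2 (some i) (by simp [Finset.mem_insertNone]), hxg _ hR⟩
          rintro ⟨o, hj⟩ hne
          refine hsup.1 o ?_
          cases o with
          | none => simp
          | some j =>
            have : j ≠ i := by
              rintro rfl
              exact hne rfl
            simpa [Finset.mem_insertNone, this] using hj
      have hind : AffineIndependent ℝ r := IsDualizable.affineIndependent fun k =>
        (hdual k).imp fun g => Exists.imp fun c hc => ⟨hc.1, hc.2.1⟩
      have hrange : Set.range r ⊆ Set.range (stackedPoints p v) := by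
        rintro _ ⟨o, rfl⟩
        exact ⟨_, rfl⟩
      have hfd : FiniteDimensional ℝ (vectorSpan ℝ (Set.range (stackedPoints p v))) :=
        finiteDimensional_vectorSpan_range ℝ _
      have hle : affineSpan ℝ (Set.range r) ≤ affineSpan ℝ (Set.range (stackedPoints p v)) :=
        affineSpan_mono ℝ hrange
      have hfd' : FiniteDimensional ℝ
          (affineSpan ℝ (Set.range (stackedPoints p v))).direction := by
        rw [direction_affineSpan]
        exact hfd
      -- These `d + 1` affinely independent points already span the whole affine hull.
      have heq := hind.affineSpan_eq_of_le_of_card_eq_finrank_add_one hle (by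
        rw [direction_affineSpan, hfin, Fintype.card_coe, Finset.card_insertNone,
          h𝓕.card_eq S hS])
      refine convexHull_mono hrange (mem_convexHull_of_dual ?_ hdual)
      rw [heq, hspan]
      exact hx

theorem IsDualizable.isRealization {p : Fin (d + 1) → E} (h : IsDualizable p) :
    IsRealization d (simplexFacets d) p := by
  refine ⟨h.affineIndependent.finrank_vectorSpan (by simp), ?_, ?_⟩
  · rintro _ ⟨i, rfl⟩
    obtain ⟨f, c, h1, h2⟩ := h i
    refine ⟨f, c, fun j hj => h1 j (by simpa using hj), fun j hj => ?_⟩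
    have : j = i := by simpa using hj
    rwa [this]
  · intro f c hf x hx hxf
    refine mem_convexHull_of_dual hx fun k => ?_
    have hk := hf _ ⟨k, rfl⟩
    exact ⟨_, _, fun j hj => hk.1 j (by simpa using hj), hk.2 k (by simp), hxf _ ⟨k, rfl⟩⟩

end Stacking

end ConvexPolytope

namespace ConvexPolytope

/-! ### Closure properties of rational data. -/

section Rational

/-- The rational numbers, as a subfield of the real numbers. -/
noncomputable def rationals : Subfield ℝ := (algebraMap ℚ ℝ).fieldRange

theorem mem_rationals_iff {x : ℝ} : x ∈ rationals ↔ ∃ q : ℚ, x = q := by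
  simp [rationals, RingHom.mem_fieldRange, eq_comm]

variable {d : ℕ}

theorem isRationalPoint_iff {x : EuclideanSpace ℝ (Fin d)} :
    IsRationalPoint x ↔ ∀ i, x i ∈ rationals := by
  simp only [IsRationalPoint, mem_rationals_iff]

theorem isRationalInequality_iff {f : EuclideanSpace ℝ (Fin d) →L[ℝ] ℝ} {c : ℝ} :
    IsRationalInequality f c ↔ (∀ i, f (EuclideanSpace.single i 1) ∈ rationals) ∧
      c ∈ rationals := by
  simp only [IsRationalInequality, mem_rationals_iff]

theorem IsRationalPoint.add {x y : EuclideanSpace ℝ (Fin d)} (hx : IsRationalPoint x)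
    (hy : IsRationalPoint y) : IsRationalPoint (x + y) := by
  rw [isRationalPoint_iff] at *
  exact fun i => add_mem (hx i) (hy i)

theorem IsRationalPoint.smul {x : EuclideanSpace ℝ (Fin d)} (hx : IsRationalPoint x) {r : ℝ}
    (hr : r ∈ rationals) : IsRationalPoint (r • x) := by
  rw [isRationalPoint_iff] at *
  exact fun i => mul_mem hr (hx i)

theorem IsRationalPoint.sub {x y : EuclideanSpace ℝ (Fin d)} (hx : IsRationalPoint x)
    (hy : IsRationalPoint y) : IsRationalPoint (x - y) := by
  rw [isRationalPoint_iff] at *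
  exact fun i => sub_mem (hx i) (hy i)

theorem IsRationalPoint.average {κ : Type*} {s : Finset κ} {u : κ → EuclideanSpace ℝ (Fin d)}
    (h : ∀ k ∈ s, IsRationalPoint (u k)) : IsRationalPoint (average s u) := by
  refine IsRationalPoint.smul ?_ (inv_mem (natCast_mem _ _))
  rw [isRationalPoint_iff]
  intro i
  rw [WithLp.ofLp_sum, Finset.sum_apply]
  exact sum_mem fun k hk => isRationalPoint_iff.1 (h k hk) i

theorem IsRationalInequality.map_mem {f : EuclideanSpace ℝ (Fin d) →L[ℝ] ℝ} {c : ℝ}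
    (hf : IsRationalInequality f c) {x : EuclideanSpace ℝ (Fin d)} (hx : IsRationalPoint x) :
    f x ∈ rationals := by
  rw [isRationalPoint_iff] at hx
  rw [isRationalInequality_iff] at hf
  rw [← (EuclideanSpace.basisFun (Fin d) ℝ).sum_repr x, map_sum]
  refine sum_mem fun i _ => ?_
  rw [map_smul]
  simpa using mul_mem (hx i) (hf.1 i)

theorem IsRationalInequality.add {f f' : EuclideanSpace ℝ (Fin d) →L[ℝ] ℝ} {c c' : ℝ}
    (h : IsRationalInequality f c) (h' : IsRationalInequality f' c') :
    IsRationalInequality (f + f') (c + c') := by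
  rw [isRationalInequality_iff] at *
  exact ⟨fun i => add_mem (h.1 i) (h'.1 i), add_mem h.2 h'.2⟩

theorem IsRationalInequality.smul {f : EuclideanSpace ℝ (Fin d) →L[ℝ] ℝ} {c r : ℝ}
    (h : IsRationalInequality f c) (hr : r ∈ rationals) :
    IsRationalInequality (r • f) (r * c) := by
  rw [isRationalInequality_iff] at *
  exact ⟨fun i => mul_mem hr (h.1 i), mul_mem hr h.2⟩

theorem IsRationalInequality.sum {κ : Type*} {s : Finset κ}
    {f : κ → EuclideanSpace ℝ (Fin d) →L[ℝ] ℝ} {c : κ → ℝ}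
    (h : ∀ k ∈ s, IsRationalInequality (f k) (c k)) :
    IsRationalInequality (∑ k ∈ s, f k) (∑ k ∈ s, c k) := by
  simp only [isRationalInequality_iff] at *
  refine ⟨fun i => ?_, sum_mem fun k hk => (h k hk).2⟩
  rw [sum_apply]
  exact sum_mem fun k hk => (h k hk).1 i

end Rational

/-! ### Rational truncations: placing the apex, cutting it off, and the base case. -/

section Truncation

variable {d : ℕ} {ι : Type*}

/-- A realization of a simplicial polytope together with half-spaces `l i x ≤ b i` that truncate
its vertices such that exactly one point remains from each edge, all with rational data. -/
structure IsRationalTruncation (d : ℕ) (𝓕 : Set (Finset ι)) (q : ι → EuclideanSpace ℝ (Fin d))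
    (l : ι → EuclideanSpace ℝ (Fin d) →L[ℝ] ℝ) (b : ι → ℝ) : Prop where
  isRealization : IsRealization d 𝓕 q
  isRationalPoint : ∀ i, IsRationalPoint (q i)
  exists_supports : ∀ S ∈ 𝓕, ∃ f c, IsRationalInequality f c ∧ Supports q (S : Set ι) f c
  isRationalInequality : ∀ i, IsRationalInequality (l i) (b i)
  lt_self : ∀ i, b i < l i (q i)
  lt_of_ne : ∀ i j, j ≠ i → l i (q j) < b i
  exists_edge_point : ∀ S ∈ 𝓕, ∀ i ∈ S, ∀ j ∈ S, i ≠ j →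
    ∃ u ∈ openSegment ℝ (q i) (q j), IsRationalPoint u ∧ l i u = b i ∧ l j u = b j

variable [DecidableEq ι] {𝓕 : Set (Finset ι)} {q : ι → EuclideanSpace ℝ (Fin d)}
  {l : ι → EuclideanSpace ℝ (Fin d) →L[ℝ] ℝ} {b : ι → ℝ}

theorem le_of_mem_openSegment {E : Type*} [NormedAddCommGroup E] [NormedSpace ℝ E] {x y u : E}
    (hu : u ∈ openSegment ℝ x y) {g : E →L[ℝ] ℝ} {c : ℝ} (hx : g x ≤ c) (hy : g y ≤ c) :
    g u ≤ c := by
  obtain ⟨s, t, hs, ht, hst, rfl⟩ := hu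
  have h1 := mul_le_mul_of_nonneg_left hx hs.le
  have h2 := mul_le_mul_of_nonneg_left hy ht.le
  simp only [map_add, map_smul, smul_eq_mul]
  calc s * g x + t * g y ≤ (s + t) * c := by linarith
    _ = c := by rw [hst, one_mul]

theorem lt_of_mem_openSegment {E : Type*} [NormedAddCommGroup E] [NormedSpace ℝ E] {x y u : E}
    (hu : u ∈ openSegment ℝ x y) {g : E →L[ℝ] ℝ} {c : ℝ} (hx : g x < c) (hy : g y ≤ c) :
    g u < c := by
  obtain ⟨s, t, hs, ht, hst, rfl⟩ := hu
  have h1 := mul_lt_mul_of_pos_left hx hs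
  have h2 := mul_le_mul_of_nonneg_left hy ht.le
  simp only [map_add, map_smul, smul_eq_mul]
  calc s * g x + t * g y < (s + t) * c := by linarith
    _ = c := by rw [hst, one_mul]

/-- There is a rational point that is beyond the facet `S`, beneath all the other facets, and in
the interior of all the truncating half-spaces. -/
theorem IsRationalTruncation.exists_apex [Fintype ι] (h : IsRationalTruncation d 𝓕 q l b)
    (h𝓕 : IsPseudomanifold d 𝓕) (hd : 3 ≤ d) {S : Finset ι} (hS : S ∈ 𝓕) :
    ∃ v, IsRationalPoint v ∧
      (∃ f c, IsRationalInequality f c ∧ Supports q (S : Set ι) f c ∧ c < f v) ∧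
      (∀ S' ∈ 𝓕, S' ≠ S →
        ∃ f c, IsRationalInequality f c ∧ Supports q (S' : Set ι) f c ∧ f v < c) ∧
      ∀ i, l i v < b i := by
  have hcard := h𝓕.card_eq S hS
  have hf : ∀ S, ∃ f c, S ∈ 𝓕 → IsRationalInequality f c ∧ Supports q (S : Set ι) f c := by
    intro S
    by_cases hS : S ∈ 𝓕
    · obtain ⟨f, c, hf⟩ := h.exists_supports S hS
      exact ⟨f, c, fun _ => hf⟩
    · exact ⟨0, 0, fun h => absurd h hS⟩
  choose f c hf using hf
  have hu : ∀ e : ι × ι, ∃ u, e ∈ S.offDiag → u ∈ openSegment ℝ (q e.1) (q e.2) ∧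
      IsRationalPoint u ∧ l e.1 u = b e.1 ∧ l e.2 u = b e.2 := by
    rintro ⟨i, j⟩
    by_cases he : (i, j) ∈ S.offDiag
    · rw [Finset.mem_offDiag] at he
      obtain ⟨u, hu⟩ := h.exists_edge_point S hS i he.1 j he.2.1 he.2.2
      exact ⟨u, fun _ => hu⟩
    · exact ⟨0, fun h => absurd h he⟩
  choose u hu using hu
  have hpair : ∀ i ∈ S, ∃ j ∈ S, j ≠ i := fun i hi =>
    Finset.exists_mem_ne (by omega) i
  obtain ⟨i₀, hi₀⟩ := Finset.card_pos.1 (by omega : 0 < S.card)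
  obtain ⟨j₀, hj₀, hij₀⟩ := hpair i₀ hi₀
  have hne : S.offDiag.Nonempty := ⟨(i₀, j₀), Finset.mem_offDiag.2 ⟨hi₀, hj₀, hij₀.symm⟩⟩
  -- The vertex `k` lies off `S`; moving away from `q k` increases `f S`.
  obtain ⟨S₁, hS₁, -, hi₁⟩ := h𝓕.exists_adjacent S hS i₀ hi₀
  obtain ⟨k, -, hk⟩ := h𝓕.exists_not_mem hS₁ hS (by rintro rfl; exact hi₁ hi₀)
  set y := average S.offDiag u with hy
  have hyS : f S y = c S := by
    refine map_average_eq hne fun e he => ?_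
    obtain ⟨⟨s, t, hs, ht, hst, hu⟩, -⟩ := hu e he
    rw [Finset.mem_offDiag] at he
    rw [← hu]
    simp only [map_add, map_smul, smul_eq_mul, (hf S hS).2.1 _ (Finset.mem_coe.2 he.1),
      (hf S hS).2.1 _ (Finset.mem_coe.2 he.2.1)]
    rw [← add_mul, hst, one_mul]
  have hyf : ∀ S' ∈ 𝓕, S' ≠ S → f S' y < c S' := by
    intro S' hS' hSS'
    refine map_average_lt (fun e he => le_of_mem_openSegment (hu e he).1 ((hf S' hS').2.le _)
      ((hf S' hS').2.le _)) ?_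
    obtain ⟨i, hi, hi'⟩ := h𝓕.exists_not_mem hS hS' hSS'
    obtain ⟨j, hj, hji⟩ := hpair i hi
    have he : (i, j) ∈ S.offDiag := Finset.mem_offDiag.2 ⟨hi, hj, hji.symm⟩
    exact ⟨_, he, lt_of_mem_openSegment (hu _ he).1 ((hf S' hS').2.2 _ (by simpa using hi'))
      ((hf S' hS').2.le _)⟩
  have hyl : ∀ i, l i y < b i := by
    intro i
    refine map_average_lt (fun e he => ?_) ?_
    · obtain ⟨h1, -, h2, h3⟩ := hu e he
      by_cases hi1 : e.1 = i
      · exact (hi1 ▸ h2).le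
      by_cases hi2 : e.2 = i
      · exact (hi2 ▸ h3).le
      exact le_of_mem_openSegment h1 (h.lt_of_ne i _ hi1).le (h.lt_of_ne i _ hi2).le
    -- This is where `3 ≤ d` matters: `S` has an edge avoiding `i`, and its point satisfies the cut
    -- at `i` strictly.
    · have : 1 < (S.erase i).card := by
        have := Finset.pred_card_le_card_erase (s := S) (a := i)
        omega
      obtain ⟨j, hj, k, hk, hjk⟩ := Finset.one_lt_card.1 this
      rw [Finset.mem_erase] at hj hk
      have he : (j, k) ∈ S.offDiag := Finset.mem_offDiag.2 ⟨hj.2, hk.2, hjk⟩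
      exact ⟨_, he, lt_of_mem_openSegment (hu _ he).1 (h.lt_of_ne i _ hj.1)
        (h.lt_of_ne i _ hk.1).le⟩
  obtain ⟨n, hn⟩ := exists_perturbation
    (Sum.elim (fun S' : {S' // S' ∈ 𝓕 ∧ S' ≠ S} => f S') l) (Sum.elim (fun S' => c S') b)
    y (y - q k) (by
      rintro (⟨S', h1, h2⟩ | i)
      · exact hyf S' h1 h2
      · exact hyl i)
  have hr : 1 / ((n : ℝ) + 1) ∈ rationals :=
    div_mem (one_mem _) (add_mem (natCast_mem _ _) (one_mem _))
  have hyr : IsRationalPoint y := IsRationalPoint.average fun e he => (hu e he).2.1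
  refine ⟨y + (1 / ((n : ℝ) + 1)) • (y - q k),
    hyr.add ((hyr.sub (h.isRationalPoint k)).smul hr),
    ⟨f S, c S, (hf S hS).1, (hf S hS).2, ?_⟩,
    fun S' hS' hne => ⟨f S', c S', (hf S' hS').1, (hf S' hS').2, hn (Sum.inl ⟨S', hS', hne⟩)⟩,
    fun i => hn (Sum.inr i)⟩
  have h1 : f S (q k) < c S := (hf S hS).2.2 k (by simpa using hk)
  have h2 : (0 : ℝ) < 1 / ((n : ℝ) + 1) := by positivity
  simp only [map_add, map_smul, map_sub, smul_eq_mul, hyS]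
  linarith [mul_pos h2 (sub_pos.2 h1)]

/-- The intersection point of a segment with a hyperplane that separates its end points. -/
theorem exists_mem_openSegment {v w : EuclideanSpace ℝ (Fin d)}
    {f : EuclideanSpace ℝ (Fin d) →L[ℝ] ℝ} {c : ℝ} (hv : IsRationalPoint v)
    (hw : IsRationalPoint w) (hf : IsRationalInequality f c) (h1 : f v < c) (h2 : c < f w) :
    ∃ t ∈ rationals, 0 < t ∧ t < 1 ∧ f ((1 - t) • v + t • w) = c := by
  have h3 : 0 < f w - f v := by linarith
  refine ⟨(c - f v) / (f w - f v), div_mem (sub_mem (isRationalInequality_iff.1 hf).2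
    (hf.map_mem hv)) (sub_mem (hf.map_mem hw) (hf.map_mem hv)), div_pos (by linarith) h3, ?_, ?_⟩
  · rw [div_lt_one h3]
    linarith
  · simp only [map_add, map_smul, smul_eq_mul]
    field_simp
    ring

/-- The half-space that truncates the new vertex. -/
theorem IsRationalTruncation.exists_cut (h : IsRationalTruncation d 𝓕 q l b)
    {S : Finset ι} {v : EuclideanSpace ℝ (Fin d)} (hv : IsRationalPoint v) {f : EuclideanSpace ℝ (Fin d) →L[ℝ] ℝ} {c : ℝ}
    (hfr : IsRationalInequality f c) (hf : Supports q (S : Set ι) f c) (hfv : c < f v)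
    (hsup : ∀ i ∈ S, ∃ g a, IsRationalInequality g a ∧
      Supports (stackedPoints q v) (Finset.insertNone (S.erase i) : Set (Option ι)) g a)
    (hl : ∀ i, l i v < b i) :
    ∃ g a, IsRationalInequality g a ∧ a < g v ∧ (∀ i, g (q i) < a) ∧
      ∀ i ∈ S, ∃ u ∈ openSegment ℝ v (q i), IsRationalPoint u ∧ g u = a ∧ l i u = b i := by
  have hg : ∀ i, ∃ g a, i ∈ S → IsRationalInequality g a ∧
      Supports (stackedPoints q v) (Finset.insertNone (S.erase i) : Set (Option ι)) g a := by
    intro i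
    by_cases hi : i ∈ S
    · obtain ⟨g, a, h⟩ := hsup i hi
      exact ⟨g, a, fun _ => h⟩
    · exact ⟨0, 0, fun h => absurd h hi⟩
  choose g a hg using hg
  -- `t i` locates where the boundary of the cut at `q i` meets the new edge from `v` to `q i`.
  choose t htr ht0 ht1 htl using fun i => exists_mem_openSegment hv (h.isRationalPoint i)
    (h.isRationalInequality i) (hl i) (h.lt_self i)
  have hgv : ∀ i ∈ S, g i v = a i := fun i hi =>
    (hg i hi).2.1 none (by simp)
  have hgne : ∀ i ∈ S, ∀ j ∈ S, j ≠ i → g i (q j) = a i := fun i hi j hj hji =>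
    (hg i hi).2.1 (some j) (by simp [Finset.mem_insertNone, hj, hji])
  have hgself : ∀ i ∈ S, g i (q i) < a i := fun i hi =>
    (hg i hi).2.2 (some i) (by simp [Finset.mem_insertNone])
  have hgle : ∀ i ∈ S, ∀ j, g i (q j) ≤ a i := fun i hi j => (hg i hi).2.le (some j)
  -- The new cut exceeds its bound by `f v - c` at `v`, and by `-D i * (a i - g i (q i))` at `q i`.
  -- `D i` makes these cancel at parameter `t i`.
  let D : ι → ℝ := fun i => (1 - t i) * (f v - c) / (t i * (a i - g i (q i)))
  have hDr : ∀ i ∈ S, D i ∈ rationals := fun i hi =>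
    div_mem (mul_mem (sub_mem (one_mem _) (htr i))
      (sub_mem (hfr.map_mem hv) (isRationalInequality_iff.1 hfr).2))
      (mul_mem (htr i) (sub_mem (isRationalInequality_iff.1 (hg i hi).1).2
        ((hg i hi).1.map_mem (h.isRationalPoint i))))
  have hDpos : ∀ i ∈ S, 0 < D i := fun i hi =>
    div_pos (mul_pos (sub_pos.2 (ht1 i)) (sub_pos.2 hfv))
      (mul_pos (ht0 i) (sub_pos.2 (hgself i hi)))
  have heval : ∀ x, (f + ∑ i ∈ S, D i • g i) x - (c + ∑ i ∈ S, D i * a i) =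
      (f x - c) + ∑ i ∈ S, D i * (g i x - a i) := by
    intro x
    simp only [add_apply, sum_apply, smul_apply, smul_eq_mul, mul_sub, Finset.sum_sub_distrib]
    ring
  have hevalv : (f + ∑ i ∈ S, D i • g i) v - (c + ∑ i ∈ S, D i * a i) = f v - c := by
    rw [heval, Finset.sum_eq_zero fun i hi => by rw [hgv i hi, sub_self, mul_zero], add_zero]
  have hevalS : ∀ j ∈ S, (f + ∑ i ∈ S, D i • g i) (q j) - (c + ∑ i ∈ S, D i * a i) =
      D j * (g j (q j) - a j) := by
    intro j hj
    rw [heval, hf.1 j hj, sub_self, zero_add, Finset.sum_eq_single_of_mem j hj]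
    intro i hi hij
    rw [hgne i hi j hj hij.symm, sub_self, mul_zero]
  refine ⟨f + ∑ i ∈ S, D i • g i, c + ∑ i ∈ S, D i * a i,
    hfr.add (IsRationalInequality.sum fun i hi => (hg i hi).1.smul (hDr i hi)), ?_, ?_, ?_⟩
  · rw [← sub_pos, hevalv]
    exact sub_pos.2 hfv
  · intro j
    rw [← sub_neg]
    by_cases hj : j ∈ S
    · rw [hevalS j hj]
      exact mul_neg_of_pos_of_neg (hDpos j hj) (sub_neg.2 (hgself j hj))
    · rw [heval]
      exact add_neg_of_neg_of_nonpos (sub_neg.2 (hf.2 j (by simpa using hj)))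
        (Finset.sum_nonpos fun i hi => mul_nonpos_of_nonneg_of_nonpos (hDpos i hi).le
          (sub_nonpos.2 (hgle i hi j)))
  · intro j hj
    refine ⟨(1 - t j) • v + t j • q j,
      ⟨1 - t j, t j, sub_pos.2 (ht1 j), ht0 j, by ring, rfl⟩,
      (hv.smul (sub_mem (one_mem _) (htr j))).add ((h.isRationalPoint j).smul (htr j)), ?_,
      htl j⟩
    have h1 := hevalS j hj
    have h2 : t j * (D j * (a j - g j (q j))) = (1 - t j) * (f v - c) := by
      have := (ht0 j).ne'
      have := (sub_pos.2 (hgself j hj)).ne'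
      simp only [D]
      field_simp
    generalize f + ∑ i ∈ S, D i • g i = G at hevalv h1 ⊢
    generalize c + ∑ i ∈ S, D i * a i = A at hevalv h1 ⊢
    simp only [map_add, map_smul, smul_eq_mul]
    linear_combination (1 - t j) * hevalv + t j * h1 - h2

/-- A truncatable realization can be stacked to a truncatable realization. -/
theorem IsRationalTruncation.exists_stack [Fintype ι] (h : IsRationalTruncation d 𝓕 q l b)
    (h𝓕 : IsPseudomanifold d 𝓕) (hd : 3 ≤ d) {S : Finset ι} (hS : S ∈ 𝓕) :
    ∃ q' l' b', IsRationalTruncation d (stackedFacets 𝓕 S) q' l' b' := by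
  obtain ⟨v, hv, ⟨f, c, hfr, hf, hfv⟩, hbeneath, hl⟩ := h.exists_apex h𝓕 hd hS
  have hsup : ∀ i ∈ S, ∃ g a, IsRationalInequality g a ∧
      Supports (stackedPoints q v) (Finset.insertNone (S.erase i) : Set (Option ι)) g a := by
    intro i hi
    obtain ⟨S', hS', h1, h2⟩ := h𝓕.exists_adjacent S hS i hi
    obtain ⟨f', c', hfr', h3, h4⟩ := hbeneath S' hS' (by rintro rfl; exact h2 hi)
    refine ⟨_, _, ?_, hf.insertNone_erase h3 h1 h2 hfv h4⟩
    exact (hfr.smul (sub_mem (isRationalInequality_iff.1 hfr').2 (hfr'.map_mem hv))).add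
      (hfr'.smul (sub_mem (hfr.map_mem hv) (isRationalInequality_iff.1 hfr).2))
  obtain ⟨g, a, hga, hgv, hgq, hu⟩ := h.exists_cut hv hfr hf hfv hsup hl
  -- The realization is full-dimensional, so any choice of `v` lies in its affine hull.
  have htop : affineSpan ℝ (Set.range q) = ⊤ := by
    have hne : (Set.range q).Nonempty := by
      obtain ⟨i, -⟩ := Finset.card_pos.1 (by rw [h𝓕.card_eq S hS]; omega : 0 < S.card)
      exact ⟨_, i, rfl⟩
    rw [AffineSubspace.affineSpan_eq_top_iff_vectorSpan_eq_top_of_nonempty ℝ _ _ hne]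
    exact Submodule.eq_top_of_finrank_eq (by rw [h.isRealization.finrank_eq]; simp)
  refine ⟨stackedPoints q v, fun o => o.elim g l, fun o => o.elim a b,
    h.isRealization.stack h𝓕 hS (by rw [htop]; trivial) hf hfv fun S' hS' hne =>
      (hbeneath S' hS' hne).imp fun _ => Exists.imp fun _ h => h.2, ?_, ?_, ?_, ?_, ?_, ?_⟩
  · rintro (_ | i)
    exacts [hv, h.isRationalPoint i]
  · rintro R (⟨S', hS', hne, rfl⟩ | ⟨i, hi, rfl⟩)
    · obtain ⟨f', c', h1, h2⟩ := hbeneath S' hS' hne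
      exact ⟨f', c', h1, supports_stackedPoints_map_some.2 h2⟩
    · exact hsup i hi
  · rintro (_ | i)
    exacts [hga, h.isRationalInequality i]
  · rintro (_ | i)
    exacts [hgv, h.lt_self i]
  · rintro (_ | i) (_ | j) hne
    · exact absurd rfl hne
    · exact hgq j
    · exact hl i
    · exact h.lt_of_ne i j fun hc => hne (congrArg some hc)
  · rintro R (⟨S', hS', -, rfl⟩ | ⟨k, hk, rfl⟩) o ho o' ho' hne
    · obtain ⟨i, hi, rfl⟩ := Finset.mem_map.1 ho
      obtain ⟨j, hj, rfl⟩ := Finset.mem_map.1 ho'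
      exact h.exists_edge_point S' hS' i hi j hj fun hc => hne (congrArg some hc)
    · have hmem : ∀ i, some i ∈ Finset.insertNone (S.erase k) → i ∈ S := fun i hi =>
        Finset.mem_of_mem_erase (Finset.some_mem_insertNone.1 hi)
      rcases o with _ | i <;> rcases o' with _ | j
      · exact absurd rfl hne
      · exact hu j (hmem j ho')
      · obtain ⟨u, h1, h2, h3, h4⟩ := hu i (hmem i ho)
        exact ⟨u, openSegment_symm ℝ v (q i) ▸ h1, h2, h4, h3⟩
      · exact h.exists_edge_point S hS i (hmem i ho) j (hmem j ho') fun hc =>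
          hne (congrArg some hc)

/-- A simplex is truncatable, with rational data. -/
theorem exists_isRationalTruncation_simplex (d : ℕ) :
    ∃ q l b, IsRationalTruncation d (simplexFacets d) q l b := by
  let q : Fin (d + 1) → EuclideanSpace ℝ (Fin d) :=
    Fin.cons 0 fun i => EuclideanSpace.single i 1
  have hq : ∀ i, IsRationalPoint (q i) := by
    intro i
    rw [isRationalPoint_iff]
    intro k
    refine Fin.cases ?_ (fun j => ?_) i
    · simp [q, zero_mem]
    · simp only [q, Fin.cons_succ, PiLp.single_apply]
      split_ifs
      exacts [one_mem _, zero_mem _]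
  have hdual : ∀ k, ∃ g c, IsRationalInequality g c ∧ (∀ j, j ≠ k → g (q j) = c) ∧
      g (q k) < c := by
    intro k
    refine Fin.cases ?_ (fun i => ?_) k
    · refine ⟨∑ i, EuclideanSpace.proj i, 1, ?_, ?_, ?_⟩
      · rw [isRationalInequality_iff]
        refine ⟨fun i => ?_, one_mem _⟩
        simp [one_mem]
      · intro j hj
        obtain ⟨j, rfl⟩ := Fin.exists_succ_eq.2 hj
        simp [q]
      · simp [q]
    · refine ⟨-EuclideanSpace.proj i, 0, ?_, ?_, ?_⟩
      · rw [isRationalInequality_iff]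
        refine ⟨fun j => ?_, zero_mem _⟩
        simp only [neg_apply, PiLp.proj_apply, PiLp.single_apply]
        split_ifs
        exacts [neg_mem (one_mem _), neg_mem (zero_mem _)]
      · intro j
        refine Fin.cases ?_ (fun j => ?_) j
        · simp [q]
        · intro hji
          have : i ≠ j := fun hc => hji (by rw [hc])
          simp [q, this]
      · simp [q]
  choose g c hgr hg1 hg2 using hdual
  have hhalf : (2⁻¹ : ℝ) ∈ rationals := inv_mem (ofNat_mem _ 2)
  have hneg : (-1 : ℝ) ∈ rationals := neg_mem (one_mem _)
  -- Cut halfway between `q i` and the opposite facet: all cuts then pass through the midpoints of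
  -- the edges.
  refine ⟨q, fun i => (-1 : ℝ) • g i, fun i => -1 * (2⁻¹ * (c i + g i (q i))),
    IsDualizable.isRealization fun k => ⟨_, _, hg1 k, hg2 k⟩, hq, ?_, ?_, ?_, ?_, ?_⟩
  · rintro _ ⟨i, rfl⟩
    refine ⟨g i, c i, hgr i, fun j hj => hg1 i j (by simpa using hj), fun j hj => ?_⟩
    have : j = i := by simpa using hj
    rw [this]
    exact hg2 i
  · intro i
    refine IsRationalInequality.smul ?_ hneg
    have := hgr i
    rw [isRationalInequality_iff] at this ⊢
    exact ⟨this.1, mul_mem hhalf (add_mem this.2 ((hgr i).map_mem (hq i)))⟩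
  · intro i
    have := hg2 i
    simp only [smul_apply, smul_eq_mul]
    linarith
  · intro i j hji
    have := hg2 i
    simp only [smul_apply, smul_eq_mul, hg1 i j hji]
    linarith
  · intro S _ i _ j _ hij
    refine ⟨(2⁻¹ : ℝ) • q i + (2⁻¹ : ℝ) • q j,
      ⟨2⁻¹, 2⁻¹, by norm_num, by norm_num, by norm_num, rfl⟩,
      ((hq i).smul hhalf).add ((hq j).smul hhalf), ?_, ?_⟩
    · simp only [smul_apply, map_add, map_smul, smul_eq_mul, hg1 i j hij.symm]
      ring
    · simp only [smul_apply, map_add, map_smul, smul_eq_mul, hg1 j i hij]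
      ring

end Truncation

end ConvexPolytope

/-! ### Induction over stackings, edges, and the conclusion. -/

namespace ConvexPolytope

/-- The two realizations `p` and `q` share only `𝓕`: the given apex is used for `p`, while `q` gets
its own apex over the same facet `S`. -/
theorem IsStacked.exists_realization {E : Type*} [NormedAddCommGroup E] [NormedSpace ℝ E]
    [FiniteDimensional ℝ E] {d : ℕ} (hd : 3 ≤ d) {P : Set E} (hP : IsStacked d P) :
    ∃ (ι : Type) (_ : Fintype ι) (_ : DecidableEq ι) (𝓕 : Set (Finset ι)) (p : ι → E),
      P = convexHull ℝ (Set.range p) ∧ IsPseudomanifold d 𝓕 ∧ IsRealization d 𝓕 p ∧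
        ∃ q l b, IsRationalTruncation d 𝓕 q l b := by
  induction hP with
  | simplex p hp =>
    exact ⟨Fin (d + 1), inferInstance, inferInstance, simplexFacets d, p, rfl,
      isPseudomanifold_simplexFacets d, hp.isDualizable.isRealization,
      exists_isRationalTruncation_simplex d⟩
  | stack P F v hP hF hv hbeyond hbeneath ih =>
    obtain ⟨ι, _, _, 𝓕, p, rfl, h𝓕, hp, q, l, b, hq⟩ := ih
    obtain ⟨S, hS, rfl⟩ := hp.exists_of_isFacet h𝓕 hF
    obtain ⟨f, c, hfc, hfv⟩ := hbeyond
    obtain ⟨f₀, c₀, hf₀⟩ := hp.exists_supports S hS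
    rw [affineSpan_convexHull] at hv
    refine ⟨Option ι, inferInstance, inferInstance, stackedFacets 𝓕 S, stackedPoints p v, ?_,
      h𝓕.stackedFacets (by omega) hS,
      hp.stack h𝓕 hS hv (hf₀.of_defines hfc) hfv fun S' hS' hne => ?_,
      hq.exists_stack h𝓕 hd hS⟩
    · rw [range_stackedPoints, Set.insert_eq, convexHull_convexHull_union_right, Set.insert_eq]
    · obtain ⟨f₁, c₁, hf₁⟩ := hp.exists_supports S' hS'
      -- Different members of `𝓕` span different facets, since a supporting inequality recovers the
      -- vertex set.
      obtain ⟨f', c', h1, h2⟩ := hbeneath _ (hp.isFacet h𝓕 (by omega) hS') fun heq => by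
        obtain ⟨i, hi, hi'⟩ := h𝓕.exists_not_mem hS hS' hne
        have := (hf₀.mem_iff i).2 hi
        rw [← heq, hf₁.mem_iff] at this
        exact hi' this
      exact ⟨f', c', hf₁.of_defines h1, h2⟩

section Edges

variable {d : ℕ} {ι : Type*} {𝓕 : Set (Finset ι)}

theorem IsEdge.mem_extremePoints {E : Type*} [NormedAddCommGroup E] [NormedSpace ℝ E] {P : Set E}
    {v w : E} (h : IsEdge P v w) : v ∈ P.extremePoints ℝ := by
  refine h.2.isExtreme.extremePoints_subset_extremePoints ?_
  rw [mem_extremePoints_iff_left]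
  refine ⟨left_mem_segment ℝ v w, ?_⟩
  rintro x hx y hy ⟨a, b, ha, hb, hab, hxy⟩
  rw [segment_eq_image'] at hx hy
  obtain ⟨s, hs, rfl⟩ := hx
  obtain ⟨t, ht, rfl⟩ := hy
  have h1 : (a * s + b * t) • (w - v) = 0 := by
    calc (a * s + b * t) • (w - v)
        = a • (v + s • (w - v)) + b • (v + t • (w - v)) - (a + b) • v := by module
      _ = 0 := by rw [hxy, hab, one_smul, sub_self]
  have h2 := (smul_eq_zero.1 h1).resolve_right (sub_ne_zero.2 h.1.symm)
  have h3 := mul_nonneg ha.le hs.1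
  have h4 := mul_nonneg hb.le ht.1
  have h5 : s = 0 := (mul_eq_zero.1 (by linarith : a * s = 0)).resolve_left ha.ne'
  simp [h5]

theorem IsEdge.symm {E : Type*} [NormedAddCommGroup E] [NormedSpace ℝ E] {P : Set E}
    {v w : E} (h : IsEdge P v w) : IsEdge P w v :=
  ⟨h.1.symm, segment_symm ℝ v w ▸ h.2⟩

/-- The end points of an edge of a simplicial polytope belong to a common facet. -/
theorem IsRealization.exists_of_isEdge [Fintype ι] {E : Type*} [NormedAddCommGroup E]
    [NormedSpace ℝ E] {p : ι → E} (h : IsRealization d 𝓕 p) (hd : 2 ≤ d) {v w : E}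
    (he : IsEdge (convexHull ℝ (Set.range p)) v w) :
    ∃ S ∈ 𝓕, ∃ i ∈ S, ∃ j ∈ S, i ≠ j ∧ p i = v ∧ p j = w := by
  obtain ⟨i, rfl⟩ := extremePoints_convexHull_subset he.mem_extremePoints
  obtain ⟨j, rfl⟩ := extremePoints_convexHull_subset he.symm.mem_extremePoints
  obtain ⟨h1, h2⟩ := h.mem_faceSets_of_isExposed he.2
  have hi : i ∈ {k | p k ∈ segment ℝ (p i) (p j)} := left_mem_segment ℝ _ _
  have hj : j ∈ {k | p k ∈ segment ℝ (p i) (p j)} := right_mem_segment ℝ _ _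
  rcases h1 with h1 | h1 | ⟨S, hS, hT⟩
  -- If the segment contained all points, the polytope would have dimension at most 1.
  · exfalso
    rw [h1, Set.image_univ] at h2
    have h3 := h.finrank_eq
    rw [← direction_affineSpan, ← affineSpan_convexHull, ← h2, ← convexHull_pair,
      affineSpan_convexHull, direction_affineSpan] at h3
    have := (collinear_iff_finrank_le_one.1 (collinear_pair ℝ (p i) (p j)))
    omega
  · rw [h1] at hi
    exact hi.elim
  · exact ⟨S, hS, i, hT hi, j, hT hj, fun hc => he.1 (by rw [hc]), rfl, rfl⟩

end Edges

section Conclusion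

variable {d : ℕ} {ι : Type*} {𝓕 : Set (Finset ι)} {q : ι → EuclideanSpace ℝ (Fin d)}
  {l : ι → EuclideanSpace ℝ (Fin d) →L[ℝ] ℝ} {b : ι → ℝ}

theorem IsRationalTruncation.injective (h : IsRationalTruncation d 𝓕 q l b) :
    Function.Injective q := by
  intro i j hij
  by_contra hne
  have h1 := h.lt_of_ne i j (Ne.symm hne)
  have h2 := h.lt_self i
  rw [hij] at h2
  exact lt_asymm h1 h2

/-- From `v` to `w`, `f` decreases and `g` increases: `f ≤ a` leaves only points from `u` onwards,
`g ≤ c` only points up to `u`. -/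
theorem eq_of_mem_segment {E : Type*} [NormedAddCommGroup E] [NormedSpace ℝ E] {v w x u : E}
    {f g : E →L[ℝ] ℝ} {a c : ℝ} (hfv : a < f v) (hfw : f w < a) (hgv : g v < c) (hgw : c < g w)
    (hx : x ∈ segment ℝ v w) (hfx : f x ≤ a) (hgx : g x ≤ c)
    (hu : u ∈ segment ℝ v w) (hfu : f u = a) (hgu : g u = c) : x = u := by
  rw [segment_eq_image_lineMap] at hx hu
  obtain ⟨s, -, rfl⟩ := hx
  obtain ⟨t, -, rfl⟩ := hu
  simp only [AffineMap.lineMap_apply_module, map_add, map_smul, smul_eq_mul] at *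
  have : s = t := by
    apply le_antisymm <;> by_contra! hc
    · have := mul_pos (sub_pos.2 hc) (sub_pos.2 (hgv.trans hgw))
      linarith
    · have := mul_pos (sub_pos.2 hc) (sub_pos.2 (hfw.trans hfv))
      linarith
  rw [this]

/-- What remains of an edge after truncation. -/
theorem IsRationalTruncation.exists_of_isEdge [Fintype ι] (h : IsRationalTruncation d 𝓕 q l b)
    (hd : 2 ≤ d) {l' : EuclideanSpace ℝ (Fin d) → EuclideanSpace ℝ (Fin d) →L[ℝ] ℝ}
    {b' : EuclideanSpace ℝ (Fin d) → ℝ} (hl' : ∀ i, l' (q i) = l i) (hb' : ∀ i, b' (q i) = b i)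
    {v w : EuclideanSpace ℝ (Fin d)} (he : IsEdge (convexHull ℝ (Set.range q)) v w) :
    ∃ u ∈ openSegment ℝ v w, IsRationalPoint u ∧
      segment ℝ v w ∩ truncate (convexHull ℝ (Set.range q)) l' b' = {u} := by
  have hv := he.mem_extremePoints
  have hw := he.symm.mem_extremePoints
  obtain ⟨S, hS, i, hi, j, hj, hij, rfl, rfl⟩ := h.isRealization.exists_of_isEdge hd he
  obtain ⟨u, hu, hur, hui, huj⟩ := h.exists_edge_point S hS i hi j hj hij
  have hu' := openSegment_subset_segment ℝ _ _ hu
  refine ⟨u, hu, hur, Set.eq_singleton_iff_unique_mem.2 ⟨⟨hu', ?_, ?_⟩, ?_⟩⟩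
  · exact (convex_convexHull ℝ _).segment_subset hv.1 hw.1 hu'
  · intro x hx
    obtain ⟨k, rfl⟩ := extremePoints_convexHull_subset hx
    rw [hl', hb']
    by_cases hki : k = i
    · rw [hki, hui]
    by_cases hkj : k = j
    · rw [hkj, huj]
    exact le_of_mem_openSegment hu (h.lt_of_ne k i (Ne.symm hki)).le
      (h.lt_of_ne k j (Ne.symm hkj)).le
  · rintro x ⟨hx, -, hx'⟩
    have h1 := hx' _ hv
    have h2 := hx' _ hw
    rw [hl', hb'] at h1 h2
    exact eq_of_mem_segment (h.lt_self i) (h.lt_of_ne i j hij.symm) (h.lt_of_ne j i hij)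
      (h.lt_self j) hx h1 h2 hu' hui huj

end Conclusion

end ConvexPolytope

theorem mainTheorem10 (d m : ℕ) (hd : 3 ≤ d) (P : Set (EuclideanSpace ℝ (Fin m)))
    (hP : ConvexPolytope.IsStacked d P) :
    ∃ Q : Set (EuclideanSpace ℝ (Fin d)),
      ConvexPolytope.IsPolytope d Q ∧
      ConvexPolytope.CombEquiv P Q ∧
      ∃ (l : EuclideanSpace ℝ (Fin d) → EuclideanSpace ℝ (Fin d) →L[ℝ] ℝ)
        (c : EuclideanSpace ℝ (Fin d) → ℝ),
        ConvexPolytope.IsTruncation Q l c ∧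
        (∀ v ∈ Q.extremePoints ℝ, ConvexPolytope.IsRationalPoint v ∧
          ConvexPolytope.IsRationalInequality (l v) (c v)) ∧
        (∀ v w, ConvexPolytope.IsEdge Q v w →
          ∀ u ∈ segment ℝ v w ∩ ConvexPolytope.truncate Q l c,
            ConvexPolytope.IsRationalPoint u) := by
  obtain ⟨ι, _, _, 𝓕, p, rfl, h𝓕, hp, q, l, b, h⟩ := hP.exists_realization hd
  have hq := h.isRealization
  -- The cuts must be indexed by points of the space; as `q` is injective they extend by zero.
  have hl' : ∀ i, Function.extend q l 0 (q i) = l i := h.injective.extend_apply l 0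
  have hb' : ∀ i, Function.extend q b 0 (q i) = b i := h.injective.extend_apply b 0
  -- A second vertex is needed for `l i ≠ 0`: the zero form cannot separate `q i` from it.
  have hnontriv : Nontrivial ι := by
    by_contra hc
    rw [not_nontrivial_iff_subsingleton] at hc
    have h1 := hq.finrank_eq
    rw [vectorSpan_of_subsingleton ℝ (Set.subsingleton_range q), finrank_bot] at h1
    omega
  refine ⟨convexHull ℝ (Set.range q), ⟨⟨Finset.univ.image q, by simp⟩, hq.hasDim (by omega)⟩,
    hp.combEquiv hq h𝓕, Function.extend q l 0, Function.extend q b 0, ⟨?_, ?_⟩, ?_, ?_⟩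
  · intro v hv
    obtain ⟨i, rfl⟩ := extremePoints_convexHull_subset hv
    rw [hl', hb']
    refine ⟨?_, h.lt_self i, ?_⟩
    · intro hc
      obtain ⟨j, hj⟩ := exists_ne i
      have h1 := h.lt_self i
      have h2 := h.lt_of_ne i j hj
      rw [hc] at h1 h2
      exact lt_asymm h1 h2
    · intro w hw hne
      obtain ⟨j, rfl⟩ := extremePoints_convexHull_subset hw
      exact h.lt_of_ne i j fun hc => hne (by rw [hc])
  · intro v w he
    obtain ⟨u, hu, -, heq⟩ := h.exists_of_isEdge (by omega) hl' hb' he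
    exact ⟨u, hu, heq⟩
  · intro v hv
    obtain ⟨i, rfl⟩ := extremePoints_convexHull_subset hv
    rw [hl', hb']
    exact ⟨h.isRationalPoint i, h.isRationalInequality i⟩
  · intro v w he x hx
    obtain ⟨u, -, hur, heq⟩ := h.exists_of_isEdge (by omega) hl' hb' he
    rw [heq] at hx
    rwa [Set.mem_singleton_iff.1 hx]
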